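/- Setting. Let $n\ge 1$ hypotheses be tested with real random $p$-values $PV_1,\dots,PV_n$ on a probability space $(\Omega,P)$, and let $I\subseteq\{1,\dots,n\}$, $I\neq\emptyset$, be the set of true hypotheses. The joint dependence is arbitrary; it is only assumed that $P(PV_i\le u)\le u$ for all $i\in I$ and $u\in(0,1)$. Let $PV_{(1)}\le\dots\le PV_{(n)}$ be the ordered $p$-values, $H_{(1)},\dots,H_{(n)}$ the corresponding hypotheses, and $\mathcal C=\{c\in\mathbb R^n : 0\le c_1\le\dots\le c_n\}$. For $c\in\mathcal C$ the step-up (SU) procedure rejects $H_{(1)},\dots,H_{(r)}$ with $r=\max\{i : PV_{(i)}\le c_i\}$, and the step-down (SD) procedure does so with $r=\max\{i : PV_{(j)}\le c_j,\ j=1,\dots,i\}$ (no rejection if the set is empty). Let $R$ be the number of rejections, $V$ the number of rejected true hypotheses, and $\mathrm{FDP}=V/R$ ($=0$ if $R=0$). Let $1\le k\le n$, $\gamma\in[0,1)$, $\alpha\in(0,1)$. The error rates $x\in\{k\text{-FWER-SU},k\text{-FWER-SD},\text{FDP-SU},\text{FDP-SD}\}$ are $P(V\ge k)$ and $P(\mathrm{FDP}>\gamma)$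 for the SU, respectively SD, procedure. Constants $c\in\mathcal C$ *control $x$ at level $\alpha$* if the error rate $x$ is $\le\alpha$ for every non-empty $I$ and all such families of $p$-values. Matrices. Define $A^x\in\mathbb R^{n\times n}$ for $1\le i,j\le n$ as follows. - $k$-FWER-SU: $A_{ij}=i\left(\frac1{j-n+i}-\frac1{j-n+i+1}\right)$ if $i\ge k$ and $n+k-i\le j<n$; $A_{in}=1$ if $i\ge k$; $A_{ij}=0$ otherwise. - $k$-FWER-SD: $A_{ij}=i/k$ if $i\ge k$ and $j=n-i+k$; $A_{ij}=0$ otherwise. - FDP-SU: let $m(l)=\lfloor\gamma l\rfloor+1$, $\widetilde M(i)=\max\{l\in\{1,\dots,n\} : m(l)\le i\}$, $g_i(l)=\max\{i-n+l,m(l)\}$ for $1\le l\le\widetilde M(i)$, $M(i)=g_i(\widetilde M(i))$ and $t_q(i)=\max g_i^{-1}(\{q\})$ for $1\le q\le M(i)$. Then $A_{ij}=i\left(\frac1q-\frac1{q+1}\right)$ if $j=t_q(i)$ with $1\le q<M(i)$; $A_{ij}=i/M(i)$ if $j=t_{M(i)}(i)$; $A_{ij}=0$ otherwise. - FDP-SD: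 let $k_i(l)=\min\{n,\,n+l-i,\,\lceil l/\gamma\rceil-1\}$ for $1\le l\le\lfloor\gamma n\rfloor+1$ (with $l/0=\infty$) and $N(i)=\min\left\{\lfloor\gamma n\rfloor+1,\ i,\ \left\lfloor\gamma\left(\frac{n-i}{1-\gamma}+1\right)\right\rfloor+1\right\}$. Let $\widetilde A_{il}=i\left(\frac1l-\frac1{l+1}\right)$ if $l<N(i)$, $\widetilde A_{i,N(i)}=i/N(i)$, and $\widetilde A_{il}=0$ if $l>N(i)$. Then $A_{ij}=\sum_{l:\,k_i(l)=j}\widetilde A_{il}$. Put $D^x(c)=\|A^x c\|_\infty$ (maximum norm). Corollary. For each of the four error rates $x$ and every $c\in\mathcal C$ with $D^x(c)\ne0$, the rescaled constants $\widetilde c=\alpha\, c/D^x(c)$ control the error rate $x$ at level $\alpha$. In particular, let $c$ be the Benjamini–Hochberg constants $c_i=i/n$ or the Lehmann–Romano constants $c_i=\frac{\lfloor\gamma i\rfloor+1}{n+\lfloor\gamma i\rfloor+1-i}$, and let $x$ be FDP-SU or FDP-SD. Then $c\in\mathcal C$, $D^x(c)>0$, and the rescaled constants $\alpha\,c/D^x(c)$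 (the rescaled procedures of Romano and Shaikh) control $P(\mathrm{FDP}>\gamma)$ at level $\alpha$. -/

import Mathlib

open MeasureTheory

universe u

namespace MultipleTesting

noncomputable section

/-! ### Critical constants, step-up and step-down procedures

Vectors in `ℝⁿ` are functions `Fin n → ℝ`; the index `i ∈ {1, …, n}` corresponds to the
element of `Fin n` whose value is `i - 1`. -/

/-- The set `𝒞` of non-decreasing, non-negative critical constants. -/
def criticalConstants (n : ℕ) : Set (Fin n → ℝ) :=
  {c | (∀ i, 0 ≤ c i) ∧ Monotone c}

/-- The ordered `p`-values. `Tuple.sort p` is the permutation that sends a rank to the index of the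
hypothesis of that rank, so it lists the hypotheses `H₍₁₎, …, H₍ₙ₎`. -/
def orderedPValues {n : ℕ} (p : Fin n → ℝ) : Fin n → ℝ :=
  fun i => p (Tuple.sort p i)

/-- `max {i | p₍ᵢ₎ ≤ cᵢ}`, and `0` if there is no such `i`. -/
def stepUpCount {n : ℕ} (c p : Fin n → ℝ) : ℕ :=
  (Finset.univ.filter fun i : Fin n => orderedPValues p i ≤ c i).sup fun i => i.val + 1

/-- `max {i | p₍ⱼ₎ ≤ cⱼ for j = 1, …, i}`, and `0` if `p₍₁₎ > c₁`. -/
def stepDownCount {n : ℕ} (c p : Fin n → ℝ) : ℕ :=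
  (Finset.univ.filter fun i : Fin n => ∀ j ≤ i, orderedPValues p j ≤ c j).sup fun i => i.val + 1

/-- The hypotheses `H₍₁₎, …, H₍ᵣ₎` with the `r` smallest `p`-values. -/
def firstHypotheses {n : ℕ} (p : Fin n → ℝ) (r : ℕ) : Finset (Fin n) :=
  (Finset.univ.filter fun i : Fin n => i.val < r).image (Tuple.sort p)

/-- The set of hypotheses rejected by the step-up procedure. -/
def stepUp {n : ℕ} (c p : Fin n → ℝ) : Finset (Fin n) :=
  firstHypotheses p (stepUpCount c p)

/-- The set of hypotheses rejected by the step-down procedure. -/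
def stepDown {n : ℕ} (c p : Fin n → ℝ) : Finset (Fin n) :=
  firstHypotheses p (stepDownCount c p)

/-! ### Generalized error rates -/

/-- The number `V` of true hypotheses (those in `I`) among the rejected ones. -/
def falseRejections {n : ℕ} (I R : Finset (Fin n)) : ℕ :=
  (R ∩ I).card

/-- The false discovery proportion `V / R`, equal to `0` if nothing is rejected. -/
def fdp {n : ℕ} (I R : Finset (Fin n)) : ℝ :=
  if R = ∅ then 0 else (falseRejections I R : ℝ) / (R.card : ℝ)

/-- `PV` is a family of random `p`-values, with arbitrary dependence, for which the `p`-values of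
the true hypotheses `i ∈ I` are stochastically larger than a uniform variable. -/
def IsPValueFamily {Ω : Type u} [MeasurableSpace Ω] (P : Measure Ω) {n : ℕ}
    (I : Finset (Fin n)) (PV : Fin n → Ω → ℝ) : Prop :=
  (∀ i, Measurable (PV i)) ∧
    ∀ i ∈ I, ∀ t : ℝ, 0 < t → t < 1 → P.real {ω | PV i ω ≤ t} ≤ t

/-- The four error rates: `k`-FWER and tail probability of the FDP, for step-up and step-down
procedures. -/
inductive ErrorRate
  | kFWERSU
  | kFWERSD
  | FDPSU
  | FDPSD

/-- The value of an error rate for the procedure with critical constants `c`, when `I` is the set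
of true hypotheses and `PV` are the `p`-values: `P (V ≥ k)` or `P (FDP > γ)`. -/
def errorRate {Ω : Type u} [MeasurableSpace Ω] (P : Measure Ω) {n : ℕ} (I : Finset (Fin n))
    (PV : Fin n → Ω → ℝ) (k : ℕ) (γ : ℝ) (c : Fin n → ℝ) : ErrorRate → ℝ
  | .kFWERSU => P.real {ω | k ≤ falseRejections I (stepUp c fun i => PV i ω)}
  | .kFWERSD => P.real {ω | k ≤ falseRejections I (stepDown c fun i => PV i ω)}
  | .FDPSU => P.real {ω | γ < fdp I (stepUp c fun i => PV i ω)}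
  | .FDPSD => P.real {ω | γ < fdp I (stepDown c fun i => PV i ω)}

/-- The set of (constants of) procedures that strongly control the error rate `x` at level `α`:
for every non-empty set of true hypotheses and all admissible distributions of the `p`-values. -/
def controllingSet (n k : ℕ) (γ : ℝ) (x : ErrorRate) (α : ℝ) : Set (Fin n → ℝ) :=
  {c | c ∈ criticalConstants n ∧
    ∀ (Ω : Type u) [MeasurableSpace Ω] (P : Measure Ω) [IsProbabilityMeasure P]
      (I : Finset (Fin n)) (PV : Fin n → Ω → ℝ),
      I.Nonempty → IsPValueFamily P I PV → errorRate P I PV k γ c x ≤ α}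

/-! ### Associated matrices

The entries are written for indices `i, j ∈ {1, …, n}`. -/

/-- Entries of the matrix for the `k`-FWER and step-up procedures. -/
def kFWERSUEntry (n k i j : ℕ) : ℝ :=
  (i : ℝ) *
    (if i < k then 0
     else if j < n + k - i then 0
     else if j < n then 1 / ((j : ℝ) - n + i) - 1 / ((j : ℝ) - n + i + 1)
     else 1 / (i : ℝ))

/-- Entries of the matrix for the `k`-FWER and step-down procedures. -/
def kFWERSDEntry (n k i j : ℕ) : ℝ :=
  (i : ℝ) * (if k ≤ i ∧ j = n - i + k then 1 / (k : ℝ) else 0)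

/-- `m(l) = ⌊γ l⌋ + 1`. -/
def suRank (γ : ℝ) (l : ℕ) : ℕ := ⌊γ * (l : ℝ)⌋₊ + 1

/-- `M̃(i) = max {l ∈ {1, …, n} | m(l) ≤ i}`. -/
def suMTilde (γ : ℝ) (n i : ℕ) : ℕ :=
  ((Finset.Icc 1 n).filter fun l => suRank γ l ≤ i).sup id

/-- `gᵢ(l) = max {i - n + l, m(l)}`; truncation of the first term at `0` is harmless because
`m(l) ≥ 1`. -/
def suG (γ : ℝ) (n i l : ℕ) : ℕ := max (i + l - n) (suRank γ l)

/-- `M(i) = gᵢ(M̃(i))`. -/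
def suM (γ : ℝ) (n i : ℕ) : ℕ := suG γ n i (suMTilde γ n i)

/-- `t_k(i) = max gᵢ⁻¹({k})`, where `gᵢ` is defined on `{1, …, M̃(i)}`. -/
def suT (γ : ℝ) (n i k : ℕ) : ℕ :=
  ((Finset.Icc 1 (suMTilde γ n i)).filter fun l => suG γ n i l = k).sup id

/-- Entries of the matrix for the FDP and step-up procedures. The positions `t_1(i), …, t_{M(i)}(i)`
are pairwise distinct, so at most one summand is non-zero. -/
def fdpSUEntry (γ : ℝ) (n i j : ℕ) : ℝ :=
  (i : ℝ) * ∑ k ∈ Finset.Icc 1 (suM γ n i),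
    if j = suT γ n i k then
      (if k < suM γ n i then 1 / (k : ℝ) - 1 / ((k : ℝ) + 1) else 1 / (k : ℝ))
    else 0

/-- `kᵢ(l) = min {n, n + l - i, ⌈l / γ⌉ - 1}`, where `l / 0 = ∞`. -/
def sdK (γ : ℝ) (n i l : ℕ) : ℕ :=
  if γ = 0 then min n (n + l - i)
  else min n (min (n + l - i) (⌈(l : ℝ) / γ⌉₊ - 1))

/-- `N(i) = min {⌊γ n⌋ + 1, i, ⌊γ ((n - i) / (1 - γ) + 1)⌋ + 1}`. -/
def sdN (γ : ℝ) (n i : ℕ) : ℕ :=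
  min (⌊γ * (n : ℝ)⌋₊ + 1) (min i (⌊γ * (((n : ℝ) - i) / (1 - γ) + 1)⌋₊ + 1))

/-- Entries of the auxiliary matrix `Ã`. -/
def fdpSDAuxEntry (γ : ℝ) (n i j : ℕ) : ℝ :=
  (i : ℝ) *
    (if j < sdN γ n i then 1 / (j : ℝ) - 1 / ((j : ℝ) + 1)
     else if j = sdN γ n i then 1 / (sdN γ n i : ℝ)
     else 0)

/-- Entries of the matrix for the FDP and step-down procedures: the sum of `Ã_{il}` over
`l ∈ kᵢ⁻¹({j})`, where `kᵢ` is defined on `{1, …, ⌊γ n⌋ + 1}`. -/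
def fdpSDEntry (γ : ℝ) (n i j : ℕ) : ℝ :=
  ∑ l ∈ (Finset.Icc 1 (⌊γ * (n : ℝ)⌋₊ + 1)).filter (fun l => sdK γ n i l = j),
    fdpSDAuxEntry γ n i l

/-- The matrix `Aˣ` associated with the error rate `x`. -/
def associatedMatrix (n k : ℕ) (γ : ℝ) : ErrorRate → Matrix (Fin n) (Fin n) ℝ
  | .kFWERSU => Matrix.of fun i j => kFWERSUEntry n k (i.val + 1) (j.val + 1)
  | .kFWERSD => Matrix.of fun i j => kFWERSDEntry n k (i.val + 1) (j.val + 1)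
  | .FDPSU => Matrix.of fun i j => fdpSUEntry γ n (i.val + 1) (j.val + 1)
  | .FDPSD => Matrix.of fun i j => fdpSDEntry γ n (i.val + 1) (j.val + 1)

/-- The scaling constant `Dˣ(c) = ‖Aˣ c‖_∞`; the norm of `Fin n → ℝ` is the maximum norm. -/
def scalingConstant {n : ℕ} (k : ℕ) (γ : ℝ) (x : ErrorRate) (c : Fin n → ℝ) : ℝ :=
  ‖(associatedMatrix n k γ x).mulVec c‖

/-- The rescaled procedure `α · c / Dˣ(c)`. -/
def rescaled {n : ℕ} (k : ℕ) (γ : ℝ) (x : ErrorRate) (α : ℝ) (c : Fin n → ℝ) : Fin n → ℝ :=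
  fun i => α * c i / scalingConstant k γ x c

/-! ### Two classical choices of critical constants -/

/-- The Benjamini–Hochberg constants `i / n`. -/
def bhConstants (n : ℕ) : Fin n → ℝ :=
  fun i => ((i.val + 1 : ℕ) : ℝ) / (n : ℝ)

/-- The Lehmann–Romano constants `(⌊γ i⌋ + 1) / (n + ⌊γ i⌋ + 1 - i)`. -/
def lrConstants (γ : ℝ) (n : ℕ) : Fin n → ℝ :=
  fun i => (suRank γ (i.val + 1) : ℝ) /
    ((n : ℝ) + (suRank γ (i.val + 1) : ℝ) - ((i.val + 1 : ℕ) : ℝ))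

end

end MultipleTesting

/-!
Fix a set `I` of `i` true hypotheses. For critical constants `c`, each of the four kinds of error
forces, for some level `l` in a range `a ≤ l ≤ m`, at least `l` of the true `p`-values to be at most
`c_{τ(l)}`, where `a`, `m` and the non-decreasing index map `τ` depend only on the error rate and on
`i` (`IsError.exists_level`). For step-up procedures `l` comes from the last rank `r` with
`p₍ᵣ₎ ≤ cᵣ`, for step-down procedures from the first rank at which the number, or the proportion, of
true hypotheses becomes too large; the bound `n - i` on the number of false hypotheses links rank
and level.

If `N(t)` is the number of true `p`-values at most `t`, then some `N(c_{τ(l)})` is at least `l` only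
if `∑ wₗ N(c_{τ(l)}) ≥ 1`, where `wₗ = 1/l - 1/(l+1)` for `l < m` and `wₘ = 1/m`: the weights from
`l₀` on add up to `1/l₀` and `N` is monotone. Since `E N(t) ≤ i t`, Markov's inequality bounds the
error rate by `i ∑ wₗ c_{τ(l)}` (`IsPValueFamily.real_exists_le_smallCount_le`). This is exactly the
`i`-th entry of `Aˣ c` (`associatedMatrix_mulVec`), so the error rate is at most `Dˣ(c)`, and after
rescaling at most `α`. The two classical families are positive and non-decreasing, and for the FDP
each row of `Aˣ` has a positive entry, whence `Dˣ(c) > 0`.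
-/

namespace MultipleTesting

noncomputable section

open Finset

/-! ### A Bonferroni inequality for increasing levels -/

/-- The weight `1/l - 1/(l+1)` for `l < m`, and `1/l` for `l ≥ m`: the coefficients for which the
sum over `l₀ ≤ l ≤ m` telescopes to `1/l₀`. -/
def levelWeight (m l : ℕ) : ℝ :=
  if l < m then 1 / (l : ℝ) - 1 / ((l : ℝ) + 1) else 1 / (l : ℝ)

theorem levelWeight_nonneg (m : ℕ) {l : ℕ} (hl : 1 ≤ l) : 0 ≤ levelWeight m l := by
  have hl' : (0 : ℝ) < l := by exact_mod_cast hl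
  unfold levelWeight
  split_ifs
  · exact sub_nonneg.2 (one_div_le_one_div_of_le hl' (by linarith))
  · positivity

theorem sum_levelWeight {l₀ m : ℕ} (h₀ : l₀ ≤ m) :
    ∑ l ∈ Icc l₀ m, levelWeight m l = 1 / (l₀ : ℝ) := by
  have key : ∀ m, l₀ ≤ m →
      ∑ l ∈ Ico l₀ m, (1 / (l : ℝ) - 1 / ((l : ℝ) + 1)) = 1 / (l₀ : ℝ) - 1 / (m : ℝ) := by
    intro m hm
    induction m, hm using Nat.le_induction with
    | base => simp
    | succ m hm ih => rw [sum_Ico_succ_top hm, ih]; push_cast; ring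
  rw [← Ico_insert_right h₀, sum_insert (by simp),
    sum_congr rfl fun l hl => by rw [levelWeight, if_pos (mem_Ico.1 hl).2], key m h₀]
  simp [levelWeight]

/-- The number of hypotheses in `I` whose `p`-value is at most `t`. -/
def smallCount {n : ℕ} (I : Finset (Fin n)) (p : Fin n → ℝ) (t : ℝ) : ℕ :=
  #{h ∈ I | p h ≤ t}

theorem smallCount_mono {n : ℕ} (I : Finset (Fin n)) (p : Fin n → ℝ) : Monotone (smallCount I p) :=
  fun _ _ hst => card_le_card fun _ hh =>
    mem_filter.2 ⟨(mem_filter.1 hh).1, (mem_filter.1 hh).2.trans hst⟩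

/-- If `l₀` of the `p`-values lie below the level `d l₀`, then the counts at the higher levels are
at least `l₀` too, and the weights from `l₀` on add up to `1/l₀`. -/
theorem one_le_sum_levelWeight_mul_smallCount {n : ℕ} {I : Finset (Fin n)} {p : Fin n → ℝ}
    {a m : ℕ} (ha : 1 ≤ a) {d : ℕ → ℝ} (hd : MonotoneOn d (Set.Icc a m))
    (h : ∃ l ∈ Icc a m, l ≤ smallCount I p (d l)) :
    1 ≤ ∑ l ∈ Icc a m, levelWeight m l * (smallCount I p (d l) : ℝ) := by
  obtain ⟨l₀, hl₀, hle⟩ := h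
  rw [mem_Icc] at hl₀
  have hpos : (0 : ℝ) < l₀ := by exact_mod_cast ha.trans hl₀.1
  calc (1 : ℝ) = ∑ l ∈ Icc l₀ m, levelWeight m l * (l₀ : ℝ) := by
        rw [← sum_mul, sum_levelWeight hl₀.2]; field_simp
    _ ≤ ∑ l ∈ Icc l₀ m, levelWeight m l * (smallCount I p (d l) : ℝ) := by
        refine sum_le_sum fun l hl => ?_
        rw [mem_Icc] at hl
        refine mul_le_mul_of_nonneg_left ?_ (levelWeight_nonneg m (by omega))
        exact_mod_cast hle.trans (smallCount_mono I p
          (hd ⟨hl₀.1, hl₀.2⟩ ⟨hl₀.1.trans hl.1, hl.2⟩ hl.1))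
    _ ≤ _ := by
        refine sum_le_sum_of_subset_of_nonneg (Icc_subset_Icc_left hl₀.1) fun l hl _ => ?_
        exact mul_nonneg (levelWeight_nonneg m (ha.trans (mem_Icc.1 hl).1)) (Nat.cast_nonneg _)

theorem IsPValueFamily.real_le {Ω : Type u} [MeasurableSpace Ω] {P : Measure Ω}
    [IsProbabilityMeasure P] {n : ℕ} {I : Finset (Fin n)} {PV : Fin n → Ω → ℝ}
    (h : IsPValueFamily P I PV) {i : Fin n} (hi : i ∈ I) {t : ℝ} (ht : 0 ≤ t) :
    P.real {ω | PV i ω ≤ t} ≤ t := by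
  rcases le_or_gt 1 t with h1 | h1
  · exact measureReal_le_one.trans h1
  · -- approximating `t` from above also covers the level `t = 0`
    refine le_of_forall_gt_imp_ge_of_dense fun s hs => ?_
    rcases le_or_gt 1 s with hs1 | hs1
    · exact measureReal_le_one.trans hs1
    · exact (measureReal_mono fun ω (hω : PV i ω ≤ t) => hω.trans hs.le).trans
        (h.2 i hi s (ht.trans_lt hs) hs1)

/-- Markov's inequality for the weighted count of small `p`-values. -/
theorem IsPValueFamily.real_exists_le_smallCount_le {Ω : Type u} [MeasurableSpace Ω]
    {P : Measure Ω} [IsProbabilityMeasure P] {n : ℕ} {I : Finset (Fin n)} {PV : Fin n → Ω → ℝ}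
    (h : IsPValueFamily P I PV) {a m : ℕ} (ha : 1 ≤ a) {d : ℕ → ℝ}
    (hd : MonotoneOn d (Set.Icc a m)) (hd₀ : ∀ l, 0 ≤ d l) :
    P.real {ω | ∃ l ∈ Icc a m, l ≤ smallCount I (fun i => PV i ω) (d l)} ≤
      #I * ∑ l ∈ Icc a m, levelWeight m l * d l := by
  have hmeas : ∀ i t, MeasurableSet {ω | PV i ω ≤ t} := fun i t =>
    measurableSet_le (h.1 i) measurable_const
  have hint : ∀ i t, Integrable ({ω | PV i ω ≤ t}.indicator (1 : Ω → ℝ)) P := fun i t =>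
    (integrable_const (1 : ℝ)).indicator (hmeas i t)
  have hcount : ∀ t, (fun ω => (smallCount I (fun i => PV i ω) t : ℝ)) =
      fun ω => ∑ i ∈ I, {ω | PV i ω ≤ t}.indicator (1 : Ω → ℝ) ω := by
    intro t
    funext ω
    simp [smallCount, Set.indicator_apply, Finset.sum_boole]
  have hci : ∀ t, Integrable (fun ω => (smallCount I (fun i => PV i ω) t : ℝ)) P := by
    intro t
    rw [hcount]
    exact integrable_finsetSum _ fun i _ => hint i t
  have hcl : ∀ t, 0 ≤ t → ∫ ω, (smallCount I (fun i => PV i ω) t : ℝ) ∂P ≤ #I * t := by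
    intro t ht
    rw [hcount, integral_finsetSum _ fun i _ => hint i t, ← nsmul_eq_mul]
    refine sum_le_card_nsmul _ _ _ fun i hi => ?_
    rw [integral_indicator_one (hmeas i t)]
    exact h.real_le hi ht
  set f : Ω → ℝ := fun ω =>
    ∑ l ∈ Icc a m, levelWeight m l * (smallCount I (fun i => PV i ω) (d l) : ℝ) with hf
  have hfi : Integrable f P := integrable_finsetSum _ fun l _ => (hci _).const_mul _
  have hf₀ : ∀ ω, 0 ≤ f ω := fun ω => sum_nonneg fun l hl =>
    mul_nonneg (levelWeight_nonneg m (ha.trans (mem_Icc.1 hl).1)) (Nat.cast_nonneg _)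
  calc _ ≤ P.real {ω | 1 ≤ f ω} :=
        measureReal_mono fun ω hω => one_le_sum_levelWeight_mul_smallCount ha hd hω
    _ ≤ ∫ ω, f ω ∂P := by
        simpa using mul_meas_ge_le_integral_of_nonneg (Filter.Eventually.of_forall hf₀) hfi 1
    _ = ∑ l ∈ Icc a m, levelWeight m l * ∫ ω, (smallCount I (fun i => PV i ω) (d l) : ℝ) ∂P := by
        rw [hf, integral_finsetSum _ fun l _ => (hci _).const_mul _]
        exact sum_congr rfl fun l _ => integral_const_mul _ _
    _ ≤ ∑ l ∈ Icc a m, levelWeight m l * (#I * d l) :=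
        sum_le_sum fun l hl => mul_le_mul_of_nonneg_left (hcl _ (hd₀ l))
          (levelWeight_nonneg m (ha.trans (mem_Icc.1 hl).1))
    _ = _ := by
        rw [mul_sum]
        exact sum_congr rfl fun l _ => by ring

/-! ### Rejections of the step-up and step-down procedures -/

/-- The vector `c` as a function of the index `j ∈ {1, …, n}`, extended by `0`. -/
def oneBased {n : ℕ} (c : Fin n → ℝ) (j : ℕ) : ℝ :=
  if h : j - 1 < n then c ⟨j - 1, h⟩ else 0

theorem oneBased_succ {n : ℕ} (c : Fin n → ℝ) (i : Fin n) : oneBased c (i.val + 1) = c i := by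
  simp [oneBased]

theorem oneBased_nonneg {n : ℕ} {c : Fin n → ℝ} (hc : c ∈ criticalConstants n) (j : ℕ) :
    0 ≤ oneBased c j := by
  unfold oneBased
  split_ifs
  · exact hc.1 _
  · exact le_rfl

theorem oneBased_mono {n : ℕ} {c : Fin n → ℝ} (hc : c ∈ criticalConstants n) {j j' : ℕ}
    (hj : 1 ≤ j) (hjj : j ≤ j') (hj' : j' ≤ n) : oneBased c j ≤ oneBased c j' := by
  unfold oneBased
  rw [dif_pos (by omega), dif_pos (by omega)]
  exact hc.2 (Fin.mk_le_mk.2 (by omega))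

/-- The number of true hypotheses among the `j` hypotheses with the smallest `p`-values. -/
def falseAmongFirst {n : ℕ} (I : Finset (Fin n)) (p : Fin n → ℝ) (j : ℕ) : ℕ :=
  falseRejections I (firstHypotheses p j)

theorem card_firstHypotheses {n : ℕ} (p : Fin n → ℝ) {r : ℕ} (hr : r ≤ n) :
    #(firstHypotheses p r) = r := by
  rw [firstHypotheses, card_image_of_injective _ (Tuple.sort p).injective, Fin.card_filter_val_lt,
    min_eq_right hr]

theorem falseAmongFirst_zero {n : ℕ} (I : Finset (Fin n)) (p : Fin n → ℝ) :
    falseAmongFirst I p 0 = 0 := by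
  simp [falseAmongFirst, falseRejections, firstHypotheses]

theorem falseAmongFirst_le_card {n : ℕ} (I : Finset (Fin n)) (p : Fin n → ℝ) (j : ℕ) :
    falseAmongFirst I p j ≤ #I :=
  card_le_card (inter_subset_right : firstHypotheses p j ∩ I ⊆ I)

/-- At most `n - #I` of the hypotheses are false. -/
theorem le_falseAmongFirst_add {n : ℕ} (I : Finset (Fin n)) (p : Fin n → ℝ) {j : ℕ} (hj : j ≤ n) :
    j + #I ≤ falseAmongFirst I p j + n := by
  have h := card_union_add_card_inter (firstHypotheses p j) I
  rw [card_firstHypotheses p hj] at h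
  have h' := card_le_univ (firstHypotheses p j ∪ I)
  rw [Fintype.card_fin] at h'
  unfold falseAmongFirst falseRejections
  omega

theorem falseAmongFirst_succ_le {n : ℕ} (I : Finset (Fin n)) (p : Fin n → ℝ) (j : ℕ) :
    falseAmongFirst I p (j + 1) ≤ falseAmongFirst I p j + 1 := by
  have hsub : firstHypotheses p j ⊆ firstHypotheses p (j + 1) :=
    image_subset_image fun i hi => by
      simp only [mem_filter, mem_univ, true_and] at hi ⊢
      omega
  have hcard : #(firstHypotheses p (j + 1) \ firstHypotheses p j) ≤ 1 := by
    rcases le_or_gt (j + 1) n with hj | hj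
    · rw [card_sdiff_of_subset hsub, card_firstHypotheses p hj,
        card_firstHypotheses p (by omega)]
      omega
    · have : firstHypotheses p (j + 1) ⊆ firstHypotheses p j :=
        image_subset_image fun i hi => by
          simp only [mem_filter, mem_univ, true_and] at hi ⊢
          omega
      rw [sdiff_eq_empty_iff_subset.2 this]
      simp
  unfold falseAmongFirst falseRejections
  calc _ ≤ #((firstHypotheses p j ∩ I) ∪ (firstHypotheses p (j + 1) \ firstHypotheses p j)) := by
        refine card_le_card fun i hi => ?_
        simp only [mem_inter, mem_union, mem_sdiff] at hi ⊢
        tauto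
    _ ≤ _ := (card_union_le _ _).trans (by omega)

theorem falseAmongFirst_le_smallCount {n : ℕ} (I : Finset (Fin n)) (p : Fin n → ℝ) (i : Fin n)
    {t : ℝ} (h : orderedPValues p i ≤ t) :
    falseAmongFirst I p (i.val + 1) ≤ smallCount I p t := by
  refine card_le_card (fun a ha => ?_ :
    firstHypotheses p (i.val + 1) ∩ I ⊆ I.filter fun h => p h ≤ t)
  simp only [firstHypotheses, mem_inter, mem_image, mem_filter, mem_univ, true_and] at ha
  obtain ⟨⟨b, hb, rfl⟩, haI⟩ := ha
  exact mem_filter.2 ⟨haI, (Tuple.monotone_sort p (Fin.le_def.2 (by omega : b.val ≤ i.val))).trans h⟩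

theorem stepUpCount_le {n : ℕ} (c p : Fin n → ℝ) : stepUpCount c p ≤ n :=
  Finset.sup_le fun i _ => i.isLt

theorem stepDownCount_le {n : ℕ} (c p : Fin n → ℝ) : stepDownCount c p ≤ n :=
  Finset.sup_le fun i _ => i.isLt

theorem falseAmongFirst_stepUpCount_le {n : ℕ} (I : Finset (Fin n)) (c p : Fin n → ℝ)
    (h : 1 ≤ stepUpCount c p) :
    falseAmongFirst I p (stepUpCount c p) ≤ smallCount I p (oneBased c (stepUpCount c p)) := by
  obtain ⟨i, hi, hir⟩ := (Finset.lt_sup_iff (a := 0)).1 (Nat.lt_of_succ_le h) |>.elim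
    fun b hb => exists_mem_eq_sup _ ⟨b, hb.1⟩ fun i : Fin n => i.val + 1
  have hir : stepUpCount c p = i.val + 1 := hir
  rw [hir, oneBased_succ]
  exact falseAmongFirst_le_smallCount I p i (mem_filter.1 hi).2

theorem falseAmongFirst_le_of_le_stepDownCount {n : ℕ} (I : Finset (Fin n)) (c p : Fin n → ℝ)
    {j : ℕ} (hj : 1 ≤ j) (h : j ≤ stepDownCount c p) :
    falseAmongFirst I p j ≤ smallCount I p (oneBased c j) := by
  obtain ⟨i, hi, hir⟩ := (Finset.le_sup_iff (Nat.lt_of_succ_le hj)).1 h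
  have hji : j - 1 < n := by omega
  have hle : (⟨j - 1, hji⟩ : Fin n) ≤ i := Fin.le_def.2 (by simp only; omega)
  have := falseAmongFirst_le_smallCount I p ⟨j - 1, hji⟩ ((mem_filter.1 hi).2 _ hle)
  rw [← oneBased_succ c] at this
  simpa [Nat.sub_add_cancel hj] using this

theorem lt_falseAmongFirst_of_lt_fdp {n : ℕ} {I : Finset (Fin n)} {p : Fin n → ℝ} {γ : ℝ}
    (hγ₀ : 0 ≤ γ) {r : ℕ} (hr : r ≤ n) (h : γ < fdp I (firstHypotheses p r)) :
    1 ≤ r ∧ γ * r < falseAmongFirst I p r := by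
  unfold fdp at h
  split_ifs at h with h0
  · exact absurd hγ₀ (not_le.2 h)
  · rw [card_firstHypotheses p hr] at h
    have hr1 : 1 ≤ r := by
      rw [← card_firstHypotheses p hr]
      exact card_pos.2 (nonempty_iff_ne_empty.2 h0)
    exact ⟨hr1, (lt_div_iff₀ (by exact_mod_cast hr1)).1 h⟩

/-! ### The step functions of the FDP step-up matrix -/

section StepUp

variable {γ : ℝ} {n i : ℕ}

theorem suRank_mono (hγ₀ : 0 ≤ γ) : Monotone (suRank γ) := fun l l' h =>
  Nat.succ_le_succ (Nat.floor_le_floor (mul_le_mul_of_nonneg_left (by exact_mod_cast h) hγ₀))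

theorem suRank_succ_le (hγ₁ : γ < 1) (l : ℕ) : suRank γ (l + 1) ≤ suRank γ l + 1 := by
  unfold suRank
  have : ⌊γ * ((l + 1 : ℕ) : ℝ)⌋₊ < ⌊γ * (l : ℝ)⌋₊ + 2 := by
    rw [Nat.floor_lt' (by omega)]
    have := Nat.lt_floor_add_one (γ * (l : ℝ))
    push_cast
    linarith
  omega

theorem suRank_one (hγ₁ : γ < 1) : suRank γ 1 = 1 := by
  simp [suRank, Nat.floor_eq_zero.2 hγ₁]

theorem suG_mono (hγ₀ : 0 ≤ γ) : Monotone (suG γ n i) := fun l l' h =>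
  max_le_max (by omega) (suRank_mono hγ₀ h)

theorem suG_succ_le (hγ₁ : γ < 1) (l : ℕ) : suG γ n i (l + 1) ≤ suG γ n i l + 1 := by
  have := suRank_succ_le hγ₁ l
  unfold suG
  omega

theorem suG_one (hγ₁ : γ < 1) (hin : i ≤ n) : suG γ n i 1 = 1 := by
  unfold suG
  rw [suRank_one hγ₁]
  omega

theorem suMTilde_le : suMTilde γ n i ≤ n :=
  Finset.sup_le fun _ hl => (mem_Icc.1 (mem_filter.1 hl).1).2

theorem le_suMTilde {l : ℕ} (hl : 1 ≤ l) (hln : l ≤ n) (h : suRank γ l ≤ i) :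
    l ≤ suMTilde γ n i :=
  le_sup (f := id) (mem_filter.2 ⟨mem_Icc.2 ⟨hl, hln⟩, h⟩)

theorem one_le_suMTilde (hγ₁ : γ < 1) (hi : 1 ≤ i) (hin : i ≤ n) :
    1 ≤ suMTilde γ n i :=
  le_suMTilde le_rfl (hi.trans hin) (by rwa [suRank_one hγ₁])

/-- Since `gᵢ` starts at `1` and has increments `0` and `1`, it attains every value
`q ∈ {1, …, M(i)}`, hence `t_q(i)` is a genuine maximum. -/
theorem suT_spec (hγ₁ : γ < 1) (hi : 1 ≤ i) (hin : i ≤ n) {q : ℕ} (hq : 1 ≤ q)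
    (hqM : q ≤ suM γ n i) :
    suT γ n i q ∈ Icc 1 (suMTilde γ n i) ∧ suG γ n i (suT γ n i q) = q := by
  classical
  have hex : ∃ l, 1 ≤ l ∧ q ≤ suG γ n i l := ⟨_, one_le_suMTilde hγ₁ hi hin, hqM⟩
  obtain ⟨h1, hl⟩ := Nat.find_spec hex
  have hle : Nat.find hex ≤ suMTilde γ n i :=
    Nat.find_min' hex ⟨one_le_suMTilde hγ₁ hi hin, hqM⟩
  have heq : suG γ n i (Nat.find hex) = q := by
    refine le_antisymm ?_ hl
    rcases Nat.eq_or_lt_of_le h1 with h | h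
    · rwa [← h, suG_one hγ₁ hin]
    · have hm := Nat.find_min hex (m := Nat.find hex - 1) (by omega)
      have hs := suG_succ_le (n := n) (i := i) hγ₁ (Nat.find hex - 1)
      rw [Nat.sub_add_cancel h1] at hs
      have : ¬ q ≤ suG γ n i (Nat.find hex - 1) := fun h' => hm ⟨by omega, h'⟩
      omega
  obtain ⟨l, hlm, hls⟩ := exists_mem_eq_sup
    ((Icc 1 (suMTilde γ n i)).filter fun l => suG γ n i l = q)
    ⟨_, mem_filter.2 ⟨mem_Icc.2 ⟨h1, hle⟩, heq⟩⟩ id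
  have hls : suT γ n i q = l := hls
  rw [hls]
  exact mem_filter.1 hlm

theorem le_suT {l : ℕ} (hl : l ∈ Icc 1 (suMTilde γ n i)) : l ≤ suT γ n i (suG γ n i l) :=
  le_sup (f := id) (mem_filter.2 ⟨hl, rfl⟩)

end StepUp

/-! ### The four matrices in a common form -/

/-- The smallest level `l` at which the counts of the true hypotheses are compared. -/
def firstLevel (k : ℕ) : ErrorRate → ℕ
  | .kFWERSU => k
  | .kFWERSD => k
  | .FDPSU => 1
  | .FDPSD => 1

/-- The largest level for `i` true hypotheses. For `i < k` there is no level in the case of the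
`k`-FWER, since there cannot be `k` false rejections. -/
def lastLevel (n k : ℕ) (γ : ℝ) (i : ℕ) : ErrorRate → ℕ
  | .kFWERSU => i
  | .kFWERSD => min k i
  | .FDPSU => suM γ n i
  | .FDPSD => sdN γ n i

/-- The index of the critical constant that bounds the `l` smallest true `p`-values, if there are
`i` true hypotheses and the level responsible for the error is `l`. -/
def levelIndex (n : ℕ) (γ : ℝ) (i : ℕ) : ErrorRate → ℕ → ℕ
  | .kFWERSU => fun l => n - i + l
  | .kFWERSD => fun l => n - i + l
  | .FDPSU => suT γ n i
  | .FDPSD => sdK γ n i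

theorem one_le_firstLevel {k : ℕ} (hk : 1 ≤ k) (x : ErrorRate) : 1 ≤ firstLevel k x := by
  cases x <;> simp [firstLevel, hk]

theorem sdK_le (γ : ℝ) (n i l : ℕ) : sdK γ n i l ≤ n := by
  unfold sdK
  split_ifs <;> exact min_le_left _ _

theorem one_le_sdK {γ : ℝ} (hγ₀ : 0 ≤ γ) (hγ₁ : γ < 1) {n i l : ℕ} (hi : 1 ≤ i) (hin : i ≤ n)
    (hl : 1 ≤ l) : 1 ≤ sdK γ n i l := by
  unfold sdK
  split_ifs with h
  · exact le_min (by omega) (by omega)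
  · have : 1 < ⌈(l : ℝ) / γ⌉₊ := by
      rw [Nat.lt_ceil, Nat.cast_one, one_lt_div (lt_of_le_of_ne hγ₀ (Ne.symm h))]
      exact hγ₁.trans_le (by exact_mod_cast hl)
    omega

theorem sdK_mono {γ : ℝ} (hγ₀ : 0 ≤ γ) (n i : ℕ) : Monotone (sdK γ n i) := by
  intro l l' h
  have hc : ⌈(l : ℝ) / γ⌉₊ ≤ ⌈(l' : ℝ) / γ⌉₊ :=
    Nat.ceil_le_ceil (div_le_div_of_nonneg_right (by exact_mod_cast h) hγ₀)
  unfold sdK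
  split_ifs
  · exact min_le_min le_rfl (by omega)
  · exact min_le_min le_rfl (min_le_min (by omega) (by omega))

section Levels

variable {n k : ℕ} {γ : ℝ} {i : ℕ}

theorem levelIndex_mem (hk : 1 ≤ k) (hγ₀ : 0 ≤ γ) (hγ₁ : γ < 1) (hi : 1 ≤ i)
    (hin : i ≤ n) (x : ErrorRate) {l : ℕ} (hl : l ∈ Icc (firstLevel k x) (lastLevel n k γ i x)) :
    levelIndex n γ i x l ∈ Icc 1 n := by
  rw [mem_Icc] at hl
  cases x <;> simp only [firstLevel, lastLevel, levelIndex, mem_Icc] at hl ⊢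
  · omega
  · omega
  · have := mem_Icc.1 (suT_spec hγ₁ hi hin hl.1 hl.2).1
    exact ⟨this.1, this.2.trans suMTilde_le⟩
  · exact ⟨one_le_sdK hγ₀ hγ₁ hi hin hl.1, sdK_le γ n i l⟩

theorem levelIndex_mono (hγ₀ : 0 ≤ γ) (hγ₁ : γ < 1) (hi : 1 ≤ i)
    (hin : i ≤ n) (x : ErrorRate) :
    MonotoneOn (levelIndex n γ i x) (Set.Icc (firstLevel k x) (lastLevel n k γ i x)) := by
  intro l hl l' hl' h
  cases x <;> simp only [firstLevel, lastLevel, levelIndex, Set.mem_Icc] at hl hl' ⊢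
  · omega
  · omega
  · have h1 := (suT_spec hγ₁ hi hin hl.1 hl.2).2
    have h2 := (suT_spec hγ₁ hi hin hl'.1 hl'.2).2
    rcases Nat.eq_or_lt_of_le h with rfl | hlt
    · exact le_rfl
    · by_contra! hcon
      have := suG_mono (n := n) (i := i) hγ₀ hcon.le
      omega
  · exact sdK_mono hγ₀ n i h

theorem kFWERSUEntry_eq_sum (hi : 1 ≤ i) (hin : i ≤ n) {j : ℕ} (hjn : j ≤ n) :
    kFWERSUEntry n k i j =
      i * ∑ l ∈ Icc k i, if j = n - i + l then levelWeight i l else 0 := by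
  rw [kFWERSUEntry]
  congr 1
  by_cases hlow : i < k
  · rw [if_pos hlow, Icc_eq_empty_of_lt hlow, sum_empty]
  rw [if_neg hlow]
  by_cases hj' : j < n + k - i
  · rw [if_pos hj', sum_eq_zero]
    intro l hl
    rw [mem_Icc] at hl
    rw [if_neg (by omega)]
  -- the only level using the `j`-th constant is `j - (n - i)`
  rw [if_neg hj', sum_eq_single (j - (n - i))]
  · have hcast : ((j - (n - i) : ℕ) : ℝ) = (j : ℝ) - n + i := by
      rw [Nat.cast_sub (by omega), Nat.cast_sub hin]
      ring
    rw [if_pos (show j = n - i + (j - (n - i)) by omega), levelWeight, hcast]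
    rcases hjn.lt_or_eq with h | rfl
    · rw [if_pos h, if_pos (by omega)]
    · rw [if_neg (lt_irrefl j), if_neg (by omega), sub_self, zero_add]
  · intro l hl hne
    rw [mem_Icc] at hl
    rw [if_neg (by omega)]
  · intro h
    rw [mem_Icc] at h
    omega

theorem kFWERSDEntry_eq_sum (j : ℕ) :
    kFWERSDEntry n k i j =
      i * ∑ l ∈ Icc k (min k i), if j = n - i + l then levelWeight (min k i) l else 0 := by
  rw [kFWERSDEntry]
  congr 1
  by_cases hlow : k ≤ i
  · simp [hlow, levelWeight]
  · rw [if_neg (fun h => hlow h.1), Icc_eq_empty_of_lt (by omega), sum_empty]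

theorem fdpSDEntry_eq_sum (j : ℕ) :
    fdpSDEntry γ n i j =
      i * ∑ l ∈ Icc 1 (sdN γ n i), if j = sdK γ n i l then levelWeight (sdN γ n i) l else 0 := by
  have hN : sdN γ n i ≤ ⌊γ * (n : ℝ)⌋₊ + 1 := min_le_left _ _
  rw [fdpSDEntry, sum_filter, mul_sum, ← sum_subset (Icc_subset_Icc_right hN)]
  · refine sum_congr rfl fun l hl => ?_
    rw [fdpSDAuxEntry, levelWeight]
    rcases (mem_Icc.1 hl).2.lt_or_eq with h | h
    · simp [h, eq_comm (a := j)]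
    · simp [h, eq_comm (a := j)]
  · intro l hl hl'
    rw [mem_Icc] at hl hl'
    rw [fdpSDAuxEntry, if_neg (show ¬ l < sdN γ n i by omega),
      if_neg (show ¬ l = sdN γ n i by omega), mul_zero, ite_self]

/-- Every entry of the `i`-th row collects the weights of the levels that use the `j`-th critical
constant. -/
theorem associatedMatrix_apply (hi : 1 ≤ i) (hin : i ≤ n) (x : ErrorRate) (a b : Fin n)
    (ha : a.val + 1 = i) :
    associatedMatrix n k γ x a b = i * ∑ l ∈ Icc (firstLevel k x) (lastLevel n k γ i x),
      if b.val + 1 = levelIndex n γ i x l then levelWeight (lastLevel n k γ i x) l else 0 := by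
  subst ha
  cases x
  · exact kFWERSUEntry_eq_sum hi hin b.isLt
  · exact kFWERSDEntry_eq_sum _
  · rfl
  · exact fdpSDEntry_eq_sum _

theorem associatedMatrix_mulVec (hk : 1 ≤ k) (hγ₀ : 0 ≤ γ) (hγ₁ : γ < 1) (hi : 1 ≤ i)
    (hin : i ≤ n) (x : ErrorRate) (c : Fin n → ℝ) (a : Fin n) (ha : a.val + 1 = i) :
    (associatedMatrix n k γ x).mulVec c a =
      i * ∑ l ∈ Icc (firstLevel k x) (lastLevel n k γ i x),
        levelWeight (lastLevel n k γ i x) l * oneBased c (levelIndex n γ i x l) := by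
  simp only [Matrix.mulVec, dotProduct, associatedMatrix_apply hi hin x a _ ha, mul_assoc,
    ← mul_sum, sum_mul]
  rw [sum_comm]
  congr 1
  refine sum_congr rfl fun l hl => ?_
  have hmem := mem_Icc.1 (levelIndex_mem hk hγ₀ hγ₁ hi hin x hl)
  rw [sum_eq_single (⟨levelIndex n γ i x l - 1, by omega⟩ : Fin n)]
  · rw [if_pos (by simp only; omega), oneBased, dif_pos (by omega)]
  · intro b _ hb
    rw [if_neg (fun h => hb (Fin.ext (by simp only; omega))), zero_mul]
  · simp

end Levels

/-! ### Errors force small true `p`-values -/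

/-- The event whose probability is the error rate `x`, as a property of the realized
`p`-values. -/
def IsError {n : ℕ} (I : Finset (Fin n)) (k : ℕ) (γ : ℝ) (c p : Fin n → ℝ) : ErrorRate → Prop
  | .kFWERSU => k ≤ falseRejections I (stepUp c p)
  | .kFWERSD => k ≤ falseRejections I (stepDown c p)
  | .FDPSU => γ < fdp I (stepUp c p)
  | .FDPSD => γ < fdp I (stepDown c p)

section Errors

variable {n k : ℕ} {γ : ℝ} {I : Finset (Fin n)} {c p : Fin n → ℝ}

theorem exists_level_of_kFWERSU (hk : 1 ≤ k) (hc : c ∈ criticalConstants n)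
    (h : k ≤ falseAmongFirst I p (stepUpCount c p)) :
    ∃ l ∈ Icc k #I, l ≤ smallCount I p (oneBased c (n - #I + l)) := by
  set r := stepUpCount c p
  have hrn : r ≤ n := stepUpCount_le c p
  have hr : 1 ≤ r := by
    by_contra! h0
    rw [Nat.lt_one_iff.1 h0, falseAmongFirst_zero] at h
    omega
  have hV := falseAmongFirst_le_card I p r
  have hI : #I ≤ n := by simpa using card_le_univ I
  have hF := le_falseAmongFirst_add I p hrn
  refine ⟨max k (r + #I - n), mem_Icc.2 ⟨le_max_left _ _, by omega⟩, ?_⟩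
  calc max k (r + #I - n) ≤ falseAmongFirst I p r := by omega
    _ ≤ _ := falseAmongFirst_stepUpCount_le I c p hr
    _ ≤ _ := smallCount_mono I p (oneBased_mono hc hr (by omega) (by omega))

theorem exists_level_of_kFWERSD (hk : 1 ≤ k) (hc : c ∈ criticalConstants n)
    (h : k ≤ falseAmongFirst I p (stepDownCount c p)) :
    ∃ l ∈ Icc k (min k #I), l ≤ smallCount I p (oneBased c (n - #I + l)) := by
  classical
  have hI : #I ≤ n := by simpa using card_le_univ I
  have hkI := h.trans (falseAmongFirst_le_card I p _)
  have hrn := stepDownCount_le c p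
  -- the rank at which the `k`-th true hypothesis is rejected
  have hex : ∃ j, k ≤ falseAmongFirst I p j := ⟨_, h⟩
  obtain ⟨j, hj⟩ : ∃ j, j = Nat.find hex := ⟨_, rfl⟩
  have hjs : k ≤ falseAmongFirst I p j := hj ▸ Nat.find_spec hex
  have hjr : j ≤ stepDownCount c p := hj ▸ Nat.find_min' hex h
  have hj1 : 1 ≤ j := by
    by_contra! h0
    rw [Nat.lt_one_iff.1 h0, falseAmongFirst_zero] at hjs
    omega
  have hpred : ¬ k ≤ falseAmongFirst I p (j - 1) := Nat.find_min hex (by omega)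
  have hsucc := falseAmongFirst_succ_le I p (j - 1)
  rw [Nat.sub_add_cancel hj1] at hsucc
  have hF := le_falseAmongFirst_add I p (hjr.trans hrn)
  refine ⟨k, mem_Icc.2 ⟨le_rfl, by omega⟩, hjs.trans ?_⟩
  exact (falseAmongFirst_le_of_le_stepDownCount I c p hj1 hjr).trans
    (smallCount_mono I p (oneBased_mono hc hj1 (by omega) (by omega)))

theorem exists_level_of_FDPSU (hγ₀ : 0 ≤ γ) (hγ₁ : γ < 1) (hI₀ : I.Nonempty)
    (hc : c ∈ criticalConstants n) (h : γ < fdp I (firstHypotheses p (stepUpCount c p))) :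
    ∃ l ∈ Icc 1 (suM γ n #I), l ≤ smallCount I p (oneBased c (suT γ n #I l)) := by
  set r := stepUpCount c p
  have hrn : r ≤ n := stepUpCount_le c p
  obtain ⟨hr, hV⟩ := lt_falseAmongFirst_of_lt_fdp hγ₀ hrn h
  have hI : #I ≤ n := by simpa using card_le_univ I
  have hF := le_falseAmongFirst_add I p hrn
  have hrank : suRank γ r ≤ falseAmongFirst I p r :=
    Nat.succ_le_of_lt ((Nat.floor_lt (by positivity)).2 hV)
  have hmem : r ∈ Icc 1 (suMTilde γ n #I) := mem_Icc.2
    ⟨hr, le_suMTilde hr hrn (hrank.trans (falseAmongFirst_le_card I p r))⟩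
  have hq : suG γ n #I r ∈ Icc 1 (suM γ n #I) := mem_Icc.2
    ⟨le_max_of_le_right (Nat.le_add_left _ _), suG_mono hγ₀ (mem_Icc.1 hmem).2⟩
  have hT := mem_Icc.1 (suT_spec hγ₁ hI₀.card_pos hI (mem_Icc.1 hq).1 (mem_Icc.1 hq).2).1
  refine ⟨suG γ n #I r, hq, ?_⟩
  calc suG γ n #I r ≤ falseAmongFirst I p r := max_le (by omega) hrank
    _ ≤ _ := falseAmongFirst_stepUpCount_le I c p hr
    _ ≤ _ := smallCount_mono I p (oneBased_mono hc hr (le_suT hmem) (hT.2.trans suMTilde_le))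

/-- At the first rank `j` at which the proportion of true hypotheses exceeds `γ`, their number `l`
satisfies `l - 1 ≤ γ (j - 1)` and `γ j < l`; together with `j - l ≤ n - #I` this yields
`j ≤ kᵢ(l)` and `l ≤ N(i)` for `i = #I`. -/
theorem exists_level_of_FDPSD (hγ₀ : 0 ≤ γ) (hγ₁ : γ < 1)
    (hc : c ∈ criticalConstants n) (h : γ < fdp I (firstHypotheses p (stepDownCount c p))) :
    ∃ l ∈ Icc 1 (sdN γ n #I), l ≤ smallCount I p (oneBased c (sdK γ n #I l)) := by
  classical
  have hrn := stepDownCount_le c p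
  have hI : #I ≤ n := by simpa using card_le_univ I
  obtain ⟨-, hV⟩ := lt_falseAmongFirst_of_lt_fdp hγ₀ hrn h
  have hex : ∃ j : ℕ, γ * j < falseAmongFirst I p j := ⟨_, hV⟩
  obtain ⟨j, hj⟩ : ∃ j, j = Nat.find hex := ⟨_, rfl⟩
  have hjs : γ * j < falseAmongFirst I p j := hj ▸ Nat.find_spec hex
  have hjr : j ≤ stepDownCount c p := hj ▸ Nat.find_min' hex hV
  have hj1 : 1 ≤ j := by
    by_contra! h0
    rw [Nat.lt_one_iff.1 h0, falseAmongFirst_zero] at hjs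
    simp at hjs
  have hpred : ¬ γ * ((j - 1 : ℕ) : ℝ) < falseAmongFirst I p (j - 1) :=
    Nat.find_min hex (by omega)
  have hsucc := falseAmongFirst_succ_le I p (j - 1)
  rw [Nat.sub_add_cancel hj1] at hsucc
  have hF := le_falseAmongFirst_add I p (hjr.trans hrn)
  have hjn : j ≤ n := hjr.trans hrn
  have hlI := falseAmongFirst_le_card I p j
  have hcount := falseAmongFirst_le_of_le_stepDownCount I c p hj1 hjr
  set l := falseAmongFirst I p j
  have hl0 : 1 ≤ l := by
    have : (0 : ℝ) < l := lt_of_le_of_lt (by positivity) hjs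
    exact_mod_cast this
  have hl1 : ((l - 1 : ℕ) : ℝ) ≤ γ * ((j - 1 : ℕ) : ℝ) := by
    refine le_trans ?_ (not_lt.1 hpred)
    exact_mod_cast (by omega : l - 1 ≤ falseAmongFirst I p (j - 1))
  rw [Nat.cast_sub hl0, Nat.cast_sub hj1, Nat.cast_one] at hl1
  have hFr : (j : ℝ) + #I ≤ l + n := by exact_mod_cast hF
  have hjnr : (j : ℝ) ≤ n := by exact_mod_cast hjn
  have hN : l ≤ sdN γ n #I := by
    refine le_min ?_ (le_min hlI ?_)
    · have : l - 1 ≤ ⌊γ * (n : ℝ)⌋₊ := by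
        refine Nat.le_floor ?_
        rw [Nat.cast_sub hl0, Nat.cast_one]
        nlinarith
      omega
    · have : l - 1 ≤ ⌊γ * (((n : ℝ) - #I) / (1 - γ) + 1)⌋₊ := by
        refine Nat.le_floor ?_
        rw [Nat.cast_sub hl0, Nat.cast_one]
        have h1 : (0 : ℝ) < 1 - γ := by linarith
        have h2 : ((l : ℝ) - 1) * (1 - γ) ≤ γ * ((n : ℝ) - #I) := by
          nlinarith [mul_le_mul_of_nonneg_left hFr hγ₀]
        have h3 : (l : ℝ) - 1 ≤ γ * ((n : ℝ) - #I) / (1 - γ) := (le_div_iff₀ h1).2 h2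
        rw [mul_add, ← mul_div_assoc]
        linarith
      omega
  have hK : j ≤ sdK γ n #I l := by
    unfold sdK
    split_ifs with hγ
    · exact le_min hjn (by omega)
    · have hγ' : 0 < γ := lt_of_le_of_ne hγ₀ (Ne.symm hγ)
      have : j < ⌈(l : ℝ) / γ⌉₊ := by
        rw [Nat.lt_ceil, lt_div_iff₀ hγ', mul_comm]
        exact hjs
      exact le_min hjn (le_min (by omega) (by omega))
  exact ⟨l, mem_Icc.2 ⟨hl0, hN⟩, hcount.trans
    (smallCount_mono I p (oneBased_mono hc hj1 hK (sdK_le γ n _ l)))⟩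

theorem IsError.exists_level (hk : 1 ≤ k) (hγ₀ : 0 ≤ γ) (hγ₁ : γ < 1) (hI₀ : I.Nonempty)
    (hc : c ∈ criticalConstants n) {x : ErrorRate} (h : IsError I k γ c p x) :
    ∃ l ∈ Icc (firstLevel k x) (lastLevel n k γ #I x),
      l ≤ smallCount I p (oneBased c (levelIndex n γ #I x l)) := by
  cases x
  · exact exists_level_of_kFWERSU hk hc h
  · exact exists_level_of_kFWERSD hk hc h
  · exact exists_level_of_FDPSU hγ₀ hγ₁ hI₀ hc h
  · exact exists_level_of_FDPSD hγ₀ hγ₁ hc h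

end Errors

/-! ### Control by the rescaled constants -/

theorem errorRate_eq {Ω : Type u} [MeasurableSpace Ω] (P : Measure Ω) {n : ℕ}
    (I : Finset (Fin n)) (PV : Fin n → Ω → ℝ) (k : ℕ) (γ : ℝ) (c : Fin n → ℝ) (x : ErrorRate) :
    errorRate P I PV k γ c x = P.real {ω | IsError I k γ c (fun i => PV i ω) x} := by
  cases x <;> rfl

/-- The row of `Aˣ` indexed by the number of true hypotheses bounds the error rate. -/
theorem errorRate_le_mulVec {Ω : Type u} [MeasurableSpace Ω] {P : Measure Ω}
    [IsProbabilityMeasure P] {n k : ℕ} {γ : ℝ} (hk : 1 ≤ k) (hγ₀ : 0 ≤ γ) (hγ₁ : γ < 1)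
    {I : Finset (Fin n)} {PV : Fin n → Ω → ℝ} (hI : I.Nonempty) (h : IsPValueFamily P I PV)
    {c : Fin n → ℝ} (hc : c ∈ criticalConstants n) (x : ErrorRate) (a : Fin n)
    (ha : a.val + 1 = #I) :
    errorRate P I PV k γ c x ≤ (associatedMatrix n k γ x).mulVec c a := by
  have hIn : #I ≤ n := by simpa using card_le_univ I
  rw [errorRate_eq, associatedMatrix_mulVec hk hγ₀ hγ₁ hI.card_pos hIn x c a ha]
  refine (measureReal_mono fun ω hω => IsError.exists_level hk hγ₀ hγ₁ hI hc hω).trans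
    (h.real_exists_le_smallCount_le (one_le_firstLevel hk x) (fun l hl l' hl' hll => ?_)
      fun l => oneBased_nonneg hc _)
  have h1 := mem_Icc.1 (levelIndex_mem hk hγ₀ hγ₁ hI.card_pos hIn x (mem_Icc.2 hl))
  have h2 := mem_Icc.1 (levelIndex_mem hk hγ₀ hγ₁ hI.card_pos hIn x (mem_Icc.2 hl'))
  exact oneBased_mono hc h1.1 (levelIndex_mono hγ₀ hγ₁ hI.card_pos hIn x hl hl' hll) h2.2

theorem rescaled_mem_controllingSet {n k : ℕ} {γ α : ℝ} (hk : 1 ≤ k) (hγ₀ : 0 ≤ γ) (hγ₁ : γ < 1)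
    (hα₀ : 0 < α) {x : ErrorRate} {c : Fin n → ℝ} (hc : c ∈ criticalConstants n)
    (hD : scalingConstant k γ x c ≠ 0) :
    rescaled k γ x α c ∈ controllingSet.{u} n k γ x α := by
  have hD' : 0 < scalingConstant k γ x c := lt_of_le_of_ne (norm_nonneg _) hD.symm
  have heq : rescaled k γ x α c = (α / scalingConstant k γ x c) • c := by
    funext i
    simp only [rescaled, Pi.smul_apply, smul_eq_mul]
    ring
  have hcrit : rescaled k γ x α c ∈ criticalConstants n :=
    ⟨fun i => div_nonneg (mul_nonneg hα₀.le (hc.1 i)) hD'.le, fun i j hij =>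
      div_le_div_of_nonneg_right (mul_le_mul_of_nonneg_left (hc.2 hij) hα₀.le) hD'.le⟩
  refine ⟨hcrit, fun Ω _ P _ I PV hI h => ?_⟩
  have hIn : #I ≤ n := by simpa using card_le_univ I
  have hI1 := hI.card_pos
  let a : Fin n := ⟨#I - 1, by omega⟩
  refine (errorRate_le_mulVec hk hγ₀ hγ₁ hI h hcrit x a (Nat.sub_add_cancel hI1)).trans ?_
  rw [heq, Matrix.mulVec_smul, Pi.smul_apply, smul_eq_mul]
  calc _ ≤ α / scalingConstant k γ x c * scalingConstant k γ x c :=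
        mul_le_mul_of_nonneg_left ((le_abs_self _).trans
          (norm_le_pi_norm ((associatedMatrix n k γ x).mulVec c) a))
          (div_nonneg hα₀.le hD'.le)
    _ = α := div_mul_cancel₀ _ hD

/-! ### The Benjamini–Hochberg and Lehmann–Romano constants -/

/-- For the two FDP error rates each row has a level, and its last weight is positive. -/
theorem scalingConstant_pos {n k : ℕ} {γ : ℝ} (hn : 1 ≤ n) (hγ₀ : 0 ≤ γ) (hγ₁ : γ < 1)
    {x : ErrorRate} (hx : x = .FDPSU ∨ x = .FDPSD) (hk : 1 ≤ k) {c : Fin n → ℝ}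
    (hc : c ∈ criticalConstants n) (hpos : ∀ i, 0 < c i) : 0 < scalingConstant k γ x c := by
  set m := lastLevel n k γ 1 x with hm
  have hm1 : firstLevel k x ≤ m := by
    rcases hx with rfl | rfl
    · exact le_max_of_le_right (Nat.le_add_left _ _)
    · exact le_min (Nat.le_add_left _ _) (le_min le_rfl (Nat.le_add_left _ _))
  have hfirst := one_le_firstLevel hk x
  have hmm : m ∈ Icc (firstLevel k x) m := mem_Icc.2 ⟨hm1, le_rfl⟩
  have hrow := associatedMatrix_mulVec hk hγ₀ hγ₁ le_rfl hn x c ⟨0, hn⟩ rfl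
  refine lt_of_lt_of_le ?_ ((le_abs_self _).trans 
    (norm_le_pi_norm ((associatedMatrix n k γ x).mulVec c) ⟨0, hn⟩))
  rw [hrow, Nat.cast_one, one_mul]
  refine sum_pos' (fun l hl => ?_) ⟨m, hmm, ?_⟩
  · exact mul_nonneg (levelWeight_nonneg _ (hfirst.trans (mem_Icc.1 hl).1)) (oneBased_nonneg hc _)
  · have hidx := mem_Icc.1 (levelIndex_mem hk hγ₀ hγ₁ le_rfl hn x hmm)
    have hm0 : (0 : ℝ) < m := by exact_mod_cast hfirst.trans hm1
    refine mul_pos ?_ ?_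
    · rw [← hm, levelWeight, if_neg (lt_irrefl m)]
      positivity
    · rw [oneBased, dif_pos (by omega)]
      exact hpos _

theorem bhConstants_pos {n : ℕ} (i : Fin n) : 0 < bhConstants n i := by
  have : 0 < n := i.pos
  unfold bhConstants
  positivity

theorem bhConstants_mem (n : ℕ) : bhConstants n ∈ criticalConstants n :=
  ⟨fun i => (bhConstants_pos i).le, fun i j hij =>
    div_le_div_of_nonneg_right (by exact_mod_cast Nat.succ_le_succ hij) (Nat.cast_nonneg n)⟩

theorem lrConstants_denom_pos (γ : ℝ) {n : ℕ} (i : Fin n) :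
    (0 : ℝ) < (n : ℝ) + (suRank γ (i.val + 1) : ℝ) - ((i.val + 1 : ℕ) : ℝ) := by
  have h1 : ((i.val + 1 : ℕ) : ℝ) ≤ n := by exact_mod_cast i.isLt
  have h2 : (1 : ℝ) ≤ suRank γ (i.val + 1) := by exact_mod_cast Nat.le_add_left 1 _
  linarith

theorem lrConstants_pos (γ : ℝ) {n : ℕ} (i : Fin n) : 0 < lrConstants γ n i :=
  div_pos (by exact_mod_cast Nat.succ_pos _) (lrConstants_denom_pos γ i)

theorem lrConstants_mem {γ : ℝ} (hγ₀ : 0 ≤ γ) (n : ℕ) :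
    lrConstants γ n ∈ criticalConstants n := by
  refine ⟨fun i => (lrConstants_pos γ i).le, fun i j hij => ?_⟩
  unfold lrConstants
  rw [div_le_div_iff₀ (lrConstants_denom_pos γ i) (lrConstants_denom_pos γ j)]
  -- `x / (x + y)` with `x = m(i)` increasing and `y = n - i` decreasing
  have hm : (suRank γ (i.val + 1) : ℝ) ≤ suRank γ (j.val + 1) := by
    exact_mod_cast suRank_mono hγ₀ (Nat.succ_le_succ hij)
  have hij' : ((i.val + 1 : ℕ) : ℝ) ≤ ((j.val + 1 : ℕ) : ℝ) := by
    exact_mod_cast Nat.succ_le_succ hij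
  have hi : ((i.val + 1 : ℕ) : ℝ) ≤ n := by exact_mod_cast i.isLt
  have hj : ((j.val + 1 : ℕ) : ℝ) ≤ n := by exact_mod_cast j.isLt
  have hs : (0 : ℝ) ≤ suRank γ (i.val + 1) := Nat.cast_nonneg _
  have key := mul_le_mul hm (sub_le_sub_left hij' (n : ℝ)) (sub_nonneg.2 hj) (hs.trans hm)
  linarith

end

end MultipleTesting

theorem mainTheorem2 (n k : ℕ) (hk : 1 ≤ k) (hkn : k ≤ n) (γ : ℝ) (hγ₀ : 0 ≤ γ) (hγ₁ : γ < 1)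
    (α : ℝ) (hα₀ : 0 < α) (hα₁ : α < 1) :
    (∀ (x : MultipleTesting.ErrorRate),
      ∀ c ∈ MultipleTesting.criticalConstants n,
        MultipleTesting.scalingConstant k γ x c ≠ 0 →
          MultipleTesting.rescaled k γ x α c ∈
            MultipleTesting.controllingSet.{u} n k γ x α) ∧
    (∀ x ∈ ({MultipleTesting.ErrorRate.FDPSU, MultipleTesting.ErrorRate.FDPSD} :
        Set MultipleTesting.ErrorRate),
      ∀ c ∈ ({MultipleTesting.bhConstants n, MultipleTesting.lrConstants γ n} :
          Set (Fin n → ℝ)),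
        c ∈ MultipleTesting.criticalConstants n ∧
          0 < MultipleTesting.scalingConstant k γ x c ∧
          MultipleTesting.rescaled k γ x α c ∈
            MultipleTesting.controllingSet.{u} n k γ x α) := by
  refine ⟨fun x c hc hD => MultipleTesting.rescaled_mem_controllingSet hk hγ₀ hγ₁ hα₀ hc hD,
    fun x hx c hc => ?_⟩
  have hmem : c ∈ MultipleTesting.criticalConstants n ∧ ∀ i, 0 < c i := by
    rcases hc with rfl | rfl
    · exact ⟨MultipleTesting.bhConstants_mem n, MultipleTesting.bhConstants_pos⟩
    · exact ⟨MultipleTesting.lrConstants_mem hγ₀ n, MultipleTesting.lrConstants_pos γ⟩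
  have hD := MultipleTesting.scalingConstant_pos (hk.trans hkn) hγ₀ hγ₁ hx hk hmem.1 hmem.2
  exact ⟨hmem.1, hD,
    MultipleTesting.rescaled_mem_controllingSet hk hγ₀ hγ₁ hα₀ hmem.1 hD.ne'⟩
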